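/- Let $(p_k)_{k\in\mathbb N}$ be real numbers with $0<p_k<1$ and put $q_k:=1-p_k$. Let $\Omega=\{-1,+1\}^{\mathbb N}$ carry the product $\sigma$-algebra and the product measure $P=\bigotimes_k(p_k\delta_{+1}+q_k\delta_{-1})$, let $X_k(\omega)=\omega_k$, and let $Y_k:=(X_k-p_k+q_k)/(2\sqrt{p_kq_k})$ be the standardized coordinates. For $f\in\ell^2(\mathbb N)$ let $J_1(f):=\sum_k f(k)Y_k$, where the series converges in $L^2(\Omega,P)$. Let $F:\Omega\to\mathbb N_0$ be a random variable such that $F=\mathbb E[F]+J_1(f)$ almost surely for some $f\in\ell^2(\mathbb N)$, and let $\mathrm{Po}(\lambda)$ be the Poisson distribution with mean $\lambda>0$. Let $d_{TV}(F,\mathrm{Po}(\lambda)):=\sup_{A\subseteq\mathbb N_0}|P(F\in A)-\mathrm{Po}(\lambda)(A)|$. Then all the terms of the two series below are nonnegative, and, with the sums taken in $[0,\infty]$, $$ \begin{aligned} d_{TV}(F,\mathrm{Po}(\lambda)) &\le \Big(1\wedge\sqrt{\tfrac{2}{e\lambda}}\Big)\,|\lambda-\mathbb E[F]|+\frac{1-e^{-\lambda}}{\lambda}\,\big|\lambda-\|f\|_{\ell^2(\mathbb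 N)}^2\big|\\ &\quad+\frac{1-e^{-\lambda}}{\lambda}\sum_{k}\frac{1}{\sqrt{p_kq_k}}\Big(|f(k)^3|+\sqrt{p_kq_k}\,(p_k-q_k)\,f(k)|f(k)|\Big)\\ &= \Big(1\wedge\sqrt{\tfrac{2}{e\lambda}}\Big)\,|\lambda-\mathbb E[F]|+\frac{1-e^{-\lambda}}{\lambda}\,|\lambda-\mathrm{Var}(F)|\\ &\quad+\frac{1-e^{-\lambda}}{\lambda}\sum_{k}\frac{1}{\sqrt{p_kq_k}}\Big(f(k)^2+\sqrt{p_kq_k}\,(p_k-q_k)\,f(k)\Big)|f(k)|. \end{aligned} $$ -/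

import Mathlib

open MeasureTheory ProbabilityTheory
open scoped NNReal ENNReal

namespace Rademacher

noncomputable section

/-- The sequence space `{-1,+1}^ℕ`; the two-point set `{-1,+1}` is realised as `ℤˣ`
(with its discrete σ-algebra), and `ℕ` (starting at `0`) indexes the coordinates. -/
abbrev Space : Type := ℕ → ℤˣ

/-- The law `p δ₊₁ + (1 - p) δ₋₁` of one coordinate with success probability `p`. -/
def coordLaw (p : Set.Ioo (0 : ℝ) 1) : Measure ℤˣ :=
  ENNReal.ofReal p • Measure.dirac 1 + ENNReal.ofReal (1 - p) • Measure.dirac (-1)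

instance (p : Set.Ioo (0 : ℝ) 1) : IsProbabilityMeasure (coordLaw p) := by
  refine ⟨?_⟩
  have h1 : (0 : ℝ) ≤ p := p.2.1.le
  have h2 : (0 : ℝ) ≤ 1 - p := sub_nonneg.2 p.2.2.le
  simp [coordLaw, ← ENNReal.ofReal_add h1 h2]

/-- The product measure `⨂ₖ (pₖ δ₊₁ + qₖ δ₋₁)` on `{-1,+1}^ℕ`, where `qₖ = 1 - pₖ`. -/
def law (p : ℕ → Set.Ioo (0 : ℝ) 1) : Measure Space :=
  Measure.infinitePi fun k => coordLaw (p k)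

instance (p : ℕ → Set.Ioo (0 : ℝ) 1) : IsProbabilityMeasure (law p) := by
  unfold law; infer_instance

/-- The Rademacher sequence: `Xₖ(ω) = ωₖ`. -/
def X (k : ℕ) (ω : Space) : ℝ := ((ω k : ℤ) : ℝ)

/-- The failure probability `qₖ = 1 - pₖ`. -/
def q (p : ℕ → Set.Ioo (0 : ℝ) 1) (k : ℕ) : ℝ := 1 - (p k : ℝ)

/-- The standard deviation scale `√(pₖ qₖ)`. -/
def s (p : ℕ → Set.Ioo (0 : ℝ) 1) (k : ℕ) : ℝ := √((p k : ℝ) * q p k)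

/-- The standardized sequence `Yₖ = (Xₖ - pₖ + qₖ) / (2 √(pₖ qₖ))`. -/
def Y (p : ℕ → Set.Ioo (0 : ℝ) 1) (k : ℕ) (ω : Space) : ℝ :=
  (X k ω - (p k : ℝ) + q p k) / (2 * s p k)

theorem measurable_X (k : ℕ) : Measurable (X k) := by
  have h : Measurable fun u : ℤˣ => (u : ℤ) := comap_measurable _
  exact (measurable_from_top (f := fun n : ℤ => (n : ℝ))).comp (h.comp (measurable_pi_apply k))

theorem memLp_Y (p : ℕ → Set.Ioo (0 : ℝ) 1) (k : ℕ) : MemLp (Y p k) 2 (law p) := by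
  have hX : MemLp (X k) 2 (law p) := by
    refine MemLp.of_bound (measurable_X k).aestronglyMeasurable 1 (ae_of_all _ fun ω => ?_)
    rcases Int.units_eq_one_or (ω k) with h | h <;> simp [X, h]
  have h := ((hX.sub (memLp_const (p k : ℝ))).add (memLp_const (q p k))).mul_const (2 * s p k)⁻¹
  exact h

/-- The discrete stochastic integral of order one, `J₁(f) = ∑ₖ f(k) Yₖ`, for `f ∈ ℓ²(ℕ)`.
The series is summed in `L²(Ω)`, where it converges because the `Yₖ` are orthonormal. -/
def J₁ (p : ℕ → Set.Ioo (0 : ℝ) 1) (f : lp (fun _ : ℕ => ℝ) 2) : Lp ℝ 2 (law p) :=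
  ∑' k, f k • (memLp_Y p k).toLp (Y p k)

/-- Total variation distance between two laws on `ℕ₀`: `sup_A |μ(A) - ν(A)|`. -/
def dTV (μ ν : Measure ℕ) : ℝ := ⨆ A : Set ℕ, |μ.real A - ν.real A|

end

end Rademacher

/-!
The proof is the Stein–Chen method combined with integration by parts in one coordinate at a time.

For `A ⊆ ℕ` let `g` solve `λ g(k + 1) - k g(k) = 1_A(k) - Po(λ)(A)`. Taking expectations at `F`
turns the distance of the two laws on `A` into `E[λ g(F + 1) - F g(F)]`. Write `F = c + J₁ f` with
`c = E F`. Since `J₁ f = ∑ f(k) Y_k` converges in `L²` and `g(F)` is bounded,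
`E[F g(F)] = c E[g(F)] + ∑ f(k) E[Y_k g(F)]`, and therefore, as `∑ f(k)² = ‖f‖²`, the expectation is
`(λ - c) E[g(F)] + (λ - ‖f‖²) E[Δg(F)] + ∑ f(k) (f(k) E[Δg(F)] - E[Y_k g(F)])`
(`Rademacher.hasSum_stein`).

The product law is invariant under resampling of the coordinate `k` (`Rademacher.law_eq_resample`),
so `E[Y_k h] = √(p_k q_k) E[h(ω_k := 1) - h(ω_k := -1)]` (`Rademacher.integral_Y_mul`). Moreover
`F(ω_k := 1) - F(ω_k := -1) = f(k) / √(p_k q_k)` almost surely (`Rademacher.J₁_update_sub`). Thus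
this quotient is an integer `m`, which gives the nonnegativity of the terms of the series, and the
`k`-th summand compares the increment of `g` over `m` steps with `m` times a weighted mean of the
one-step increments at the two ends. A telescoping argument bounds the difference by
`sup |Δg| (m² + (p_k - q_k) m)` (`SteinChen.abs_increment_sub_le`), which is the `k`-th term of the
series.

It remains to bound `g`. The estimate `|Δg| ≤ (1 - e^{-λ}) / λ` (`SteinChen.solAux_succ_sub_le`) is
the usual monotonicity argument. For the supremum, `|g(k + 1)| ≤ S (1 - S) / (λ w)` with
`S = Po(λ)([0, k])` and `w = Po(λ){k}`. The bound `√(2 / (eλ))` is obtained by fixing `k` and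
varying `λ`: the function `G = S (1 - S) / (w √λ)` tends to `0` at both ends of `(0, ∞)`, and at a
critical point it satisfies an equation which, by a crude Stirling estimate for `w`, forces
`G² ≤ 2 / e` (`SteinChen.exp_logRatio_sq_le`).
-/

/-! ### Poisson weights and distribution functions -/

namespace SteinChen

open Real Finset

/-- The Poisson weight `e⁻ˣ xᵏ / k!`, as a function of a real parameter `x`. -/
noncomputable def weight (k : ℕ) (x : ℝ) : ℝ := exp (-x) * x ^ k / k.factorial

/-- The Poisson distribution function `∑_{i ≤ k} e⁻ˣ xⁱ / i!`, as a function of a real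
parameter `x`. -/
noncomputable def cdf (k : ℕ) (x : ℝ) : ℝ := ∑ i ∈ range (k + 1), weight i x

theorem weight_pos (k : ℕ) {x : ℝ} (hx : 0 < x) : 0 < weight k x := by
  unfold weight; positivity

theorem cdf_pos (k : ℕ) {x : ℝ} (hx : 0 < x) : 0 < cdf k x :=
  sum_pos (fun i _ => weight_pos i hx) ⟨0, by simp⟩

theorem succ_mul_weight_succ (k : ℕ) (x : ℝ) :
    ((k : ℝ) + 1) * weight (k + 1) x = x * weight k x := by
  have : (0 : ℝ) < k.factorial := by positivity
  unfold weight
  rw [Nat.factorial_succ]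
  push_cast
  field_simp
  ring

theorem hasDerivAt_weight_zero (x : ℝ) : HasDerivAt (weight 0) (-weight 0 x) x := by
  have h := (hasDerivAt_neg x).exp
  refine (h.congr_deriv ?_).congr_of_eventuallyEq (Filter.Eventually.of_forall fun y => ?_) <;>
    simp [weight]

theorem hasDerivAt_weight_succ (k : ℕ) (x : ℝ) :
    HasDerivAt (weight (k + 1)) (weight k x - weight (k + 1) x) x := by
  have h := (((hasDerivAt_neg x).exp).mul (hasDerivAt_pow (k + 1) x)).div_const
    ((k + 1).factorial : ℝ)
  refine h.congr_deriv ?_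
  have : (0 : ℝ) < k.factorial := by positivity
  unfold weight
  rw [Nat.factorial_succ]
  push_cast
  field_simp
  ring

/-- The derivatives of the weights telescope. -/
theorem hasDerivAt_cdf (k : ℕ) (x : ℝ) : HasDerivAt (cdf k) (-weight k x) x := by
  induction k with
  | zero =>
    have : cdf 0 = weight 0 := by ext y; simp [cdf]
    rw [this]
    exact hasDerivAt_weight_zero x
  | succ k ih =>
    have : cdf (k + 1) = fun y => cdf k y + weight (k + 1) y := by
      ext y; simp [cdf, sum_range_succ _ (k + 1)]
    rw [this]
    exact (ih.add (hasDerivAt_weight_succ k x)).congr_deriv (by ring)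

theorem cdf_apply_zero (k : ℕ) : cdf k 0 = 1 := by
  rw [cdf, sum_range_succ']
  simp [weight]

/-- The mean value theorem for `cdf k` on `[0, x]`. -/
theorem exists_one_sub_cdf_eq (k : ℕ) {x : ℝ} (hx : 0 < x) :
    ∃ t, 0 < t ∧ t < x ∧ 1 - cdf k x = x * weight k t := by
  obtain ⟨t, ht, h⟩ := exists_hasDerivAt_eq_slope (cdf k) (fun t => -weight k t) hx
    (fun y _ => (hasDerivAt_cdf k y).continuousAt.continuousWithinAt)
    (fun y _ => hasDerivAt_cdf k y)
  refine ⟨t, ht.1, ht.2, ?_⟩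
  rw [cdf_apply_zero, sub_zero, eq_div_iff hx.ne'] at h
  linarith

theorem one_sub_cdf_pos (k : ℕ) {x : ℝ} (hx : 0 < x) : 0 < 1 - cdf k x := by
  obtain ⟨t, h0, -, h⟩ := exists_one_sub_cdf_eq k hx
  rw [h]
  exact mul_pos hx (weight_pos k h0)

theorem log_weight (k : ℕ) {x : ℝ} (hx : 0 < x) :
    log (weight k x) = -x + k * log x - log k.factorial := by
  have : (0 : ℝ) < k.factorial := by positivity
  rw [weight, log_div (by positivity) this.ne', log_mul (by positivity) (by positivity), log_exp,
    log_pow]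

/-- A crude form of Stirling's upper bound, centred at `k + 1/2`. -/
theorem log_factorial_le (k : ℕ) :
    log k.factorial ≤ (k + 1 / 2) * log (k + 1 / 2) - (k + 1 / 2) + 1 := by
  rcases k with _ | k
  · have h := one_sub_inv_le_log_of_pos (show (0 : ℝ) < 1 / 2 by norm_num)
    norm_num at h ⊢
    linarith
  · have h1 : log (Stirling.stirlingSeq (k + 1)) ≤ log (Stirling.stirlingSeq 1) :=
      Stirling.log_stirlingSeq'_antitone (Nat.zero_le k)
    rw [Stirling.log_stirlingSeq_formula, Stirling.stirlingSeq_one,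
      log_div (exp_pos 1).ne' (by positivity), log_exp, log_sqrt (by norm_num)] at h1
    push_cast at h1 ⊢
    have hk : (0 : ℝ) < (k : ℝ) + 1 := by positivity
    rw [log_mul (by norm_num) hk.ne', log_div hk.ne' (by positivity), log_exp] at h1
    have h2 := one_sub_inv_le_log_of_pos (show 0 < ((k : ℝ) + 1 + 1 / 2) / (k + 1) by positivity)
    rw [log_div (by positivity) hk.ne', inv_div] at h2
    have h3 : 1 - ((k : ℝ) + 1) / (k + 1 + 1 / 2) = 1 / 2 / (k + 1 + 1 / 2) := by
      field_simp; ring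
    rw [h3, div_le_iff₀ (by positivity)] at h2
    linarith

/-- A Gaussian-type lower bound for the Poisson weights, uniform in `k` and `x`. -/
theorem neg_one_sub_le_log_weight (k : ℕ) {x : ℝ} (hx : 0 < x) :
    -1 - (k + 1 / 2 - x) ^ 2 / x ≤ -x + (k + 1 / 2) * log x - log k.factorial := by
  have hn : (0 : ℝ) < k + 1 / 2 := by positivity
  have h1 := log_factorial_le k
  have h2 := one_sub_inv_le_log_of_pos (div_pos hx hn)
  rw [log_div hx.ne' hn.ne', inv_div] at h2
  have h3 := mul_le_mul_of_nonneg_left h2 hn.le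
  have h4 : ((k : ℝ) + 1 / 2 - x) ^ 2 / x
      = -((k + 1 / 2) * (1 - (k + 1 / 2) / x)) - (k + 1 / 2) + x := by
    field_simp; ring
  linarith

/-- For `x > 0`, the logarithm of `cdf k x * (1 - cdf k x) / (weight k x * √x)`, with the logarithm
of the denominator expanded. -/
noncomputable def logRatio (k : ℕ) (x : ℝ) : ℝ :=
  log (cdf k x) + log (1 - cdf k x) - (-x + (k + 1 / 2) * log x - log k.factorial)

theorem exp_logRatio (k : ℕ) {x : ℝ} (hx : 0 < x) :
    exp (logRatio k x) = cdf k x * (1 - cdf k x) / (weight k x * √x) := by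
  have hw := weight_pos k hx
  have h : -x + ((k : ℝ) + 1 / 2) * log x - log k.factorial = log (weight k x * √x) := by
    rw [log_mul hw.ne' (by positivity), log_weight k hx, log_sqrt hx.le]; ring
  rw [logRatio, h, exp_sub, exp_add, exp_log (cdf_pos k hx), exp_log (one_sub_cdf_pos k hx),
    exp_log (by positivity)]

theorem hasDerivAt_logRatio (k : ℕ) {x : ℝ} (hx : 0 < x) :
    HasDerivAt (logRatio k) (-weight k x / cdf k x + weight k x / (1 - cdf k x)
      - (-1 + (k + 1 / 2) * x⁻¹)) x := by
  have h1 := (hasDerivAt_cdf k x).log (cdf_pos k hx).ne'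
  have h2 := ((hasDerivAt_cdf k x).const_sub 1).log (one_sub_cdf_pos k hx).ne'
  have h3 := (((hasDerivAt_neg x).add ((hasDerivAt_log hx.ne').const_mul
    ((k : ℝ) + 1 / 2))).sub_const (log k.factorial))
  rw [neg_neg] at h2
  exact (h1.add h2).sub h3

/-- At a critical point `x`, with `G = exp (logRatio k x)` and `y = (k + 1/2 - x)² / x`, the
critical equation reads `(2 * cdf k x - 1)² = G² y`, so that `4 * cdf * (1 - cdf) = 1 - G² y`.
The weight is at least of order `e⁻ʸ`, and this forces `G² ≤ 2 / e`. -/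
theorem exp_logRatio_sq_le_of_critical (k : ℕ) {x : ℝ} (hx : 0 < x)
    (h : -weight k x / cdf k x + weight k x / (1 - cdf k x) - (-1 + (k + 1 / 2) * x⁻¹) = 0) :
    exp (logRatio k x) ^ 2 ≤ 2 / exp 1 := by
  have hw := weight_pos k hx
  have hS := cdf_pos k hx
  have hT := one_sub_cdf_pos k hx
  have hq : 0 < √x := sqrt_pos.2 hx
  have hqx : √x ^ 2 = x := sq_sqrt hx.le
  have hG := exp_logRatio k hx
  have hlow : exp (-1 - (k + 1 / 2 - x) ^ 2 / x) ≤ weight k x * √x := by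
    rw [← exp_log (mul_pos hw hq), exp_le_exp, log_mul hw.ne' hq.ne', log_weight k hx,
      log_sqrt hx.le]
    linarith [neg_one_sub_le_log_weight k hx]
  set G := exp (logRatio k x) with hGdef
  have hGpos : 0 < G := exp_pos _
  set S := cdf k x
  set w := weight k x
  set y := ((k : ℝ) + 1 / 2 - x) ^ 2 / x with hy
  have hy0 : 0 ≤ y := by positivity
  have hGw : G * (w * √x) = S * (1 - S) := by
    rw [hG]; field_simp
  have hcrit : 2 * S - 1 = G * √x * ((k + 1 / 2 - x) / x) := by
    field_simp at h hGw ⊢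
    have h' : w * x * (2 * S - 1) = (k + 1 / 2 - x) * (S * (1 - S)) := by
      linarith
    have : w * (x * (2 * S - 1)) = w * (G * √x * (k + 1 / 2 - x)) := by
      rw [← hGw] at h'; linarith
    have := mul_left_cancel₀ hw.ne' this
    linarith
  have hsq : (2 * S - 1) ^ 2 = G ^ 2 * y := by
    rw [hcrit, hy, mul_pow, mul_pow, hqx]; field_simp
  have h4 : 4 * G * (w * √x) = 1 - G ^ 2 * y := by
    have : 4 * (S * (1 - S)) = 1 - (2 * S - 1) ^ 2 := by ring
    rw [mul_assoc, hGw, this, hsq]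
  by_contra! hcon
  -- the tangent to `exp (-y)` at `y = e / 2 - 1` is proportional to `1 - (2 / e) y`
  have htan : exp (1 - exp 1 / 2) * (exp 1 / 2 - y) ≤ exp (-y) := by
    have := add_one_le_exp (exp 1 / 2 - 1 - y)
    calc exp (1 - exp 1 / 2) * (exp 1 / 2 - y)
        ≤ exp (1 - exp 1 / 2) * exp (exp 1 / 2 - 1 - y) := by gcongr; linarith
      _ = exp (-y) := by rw [← exp_add]; ring_nf
  have h5 : 1 - G ^ 2 * y ≤ 2 / exp 1 * (exp 1 / 2 - y) := by
    have : 2 / exp 1 * y ≤ G ^ 2 * y := by gcongr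
    have h6 : 2 / exp 1 * (exp 1 / 2 - y) = 1 - 2 / exp 1 * y := by
      field_simp
    linarith
  have h6 : 4 * G * exp (-1) * exp (-y) ≤ 1 - G ^ 2 * y := by
    rw [← h4, mul_assoc (4 * G), ← exp_add]
    gcongr
    rwa [← sub_eq_add_neg]
  have h7 : 4 * G * exp (-1) * exp (-y) ≤ 2 / exp 1 * (exp (exp 1 / 2 - 1) * exp (-y)) := by
    refine (h6.trans h5).trans ?_
    gcongr
    have := mul_le_mul_of_nonneg_left htan (exp_pos (exp 1 / 2 - 1)).le
    rwa [← mul_assoc, ← exp_add, show exp 1 / 2 - 1 + (1 - exp 1 / 2) = 0 by ring, exp_zero,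
      one_mul] at this
  have h8 : 2 * G ≤ exp (exp 1 / 2 - 1) := by
    rw [← mul_assoc, mul_le_mul_iff_left₀ (exp_pos _), exp_neg, div_mul_eq_mul_div,
      ← div_eq_mul_inv, div_le_div_iff_of_pos_right (exp_pos 1)] at h7
    linarith
  have h9 : 4 * G ^ 2 ≤ exp (exp 1 - 2) := by
    calc 4 * G ^ 2 = (2 * G) ^ 2 := by ring
      _ ≤ exp (exp 1 / 2 - 1) ^ 2 := by gcongr
      _ = exp (exp 1 - 2) := by rw [← exp_nat_mul]; push_cast; ring_nf
  have h10 : exp (exp 1 - 2) * exp 1 ≤ 8 := by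
    rw [← exp_add]
    have he := exp_one_lt_d9
    calc exp (exp 1 - 2 + 1) ≤ exp (1 + 1) := by gcongr; linarith
      _ = exp 1 * exp 1 := exp_add _ _
      _ ≤ 2.7182818286 * 2.7182818286 := by gcongr
      _ ≤ 8 := by norm_num
  rw [div_lt_iff₀ (exp_pos 1)] at hcon
  nlinarith [exp_pos (1 : ℝ)]

theorem exp_logRatio_le_sqrt_mul_exp (k : ℕ) {x : ℝ} (hx : 0 < x) :
    exp (logRatio k x) ≤ √x * exp x := by
  obtain ⟨t, h0, h1, h⟩ := exists_one_sub_cdf_eq k hx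
  have hw := weight_pos k hx
  have hq : 0 < √x := sqrt_pos.2 hx
  have hqx : √x * √x = x := mul_self_sqrt hx.le
  have hS : cdf k x ≤ 1 := by linarith [one_sub_cdf_pos k hx]
  have hwt : weight k t ≤ exp x * weight k x := by
    unfold weight
    calc exp (-t) * t ^ k / k.factorial ≤ 1 * x ^ k / k.factorial := by
          gcongr
          exact exp_le_one_iff.2 (by linarith)
      _ = exp x * (exp (-x) * x ^ k / k.factorial) := by
          rw [mul_div_assoc, mul_div_assoc, ← mul_assoc, ← exp_add, add_neg_cancel, exp_zero]
  rw [exp_logRatio k hx, div_le_iff₀ (by positivity), h]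
  calc cdf k x * (x * weight k t) ≤ 1 * (x * (exp x * weight k x)) := by
        gcongr
        exact mul_nonneg hx.le (weight_pos k h0).le
    _ = √x * exp x * (weight k x * √x) := by linear_combination (-(exp x * weight k x)) * hqx

theorem exp_logRatio_le_div_sqrt (k : ℕ) {x : ℝ} (hx : 1 ≤ x) :
    exp (logRatio k x) ≤ (k + 1) * k.factorial / √x := by
  have hx0 : 0 < x := by linarith
  have hw := weight_pos k hx0
  have hS : cdf k x ≤ (k + 1) * (k.factorial * weight k x) := by
    have : ∀ i ∈ range (k + 1), weight i x ≤ k.factorial * weight k x := by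
      intro i hi
      have hik : i ≤ k := by simpa [Nat.lt_succ_iff] using hi
      have h1 : (1 : ℝ) ≤ i.factorial := by exact_mod_cast Nat.factorial_pos i
      unfold weight
      calc exp (-x) * x ^ i / i.factorial ≤ exp (-x) * x ^ k / 1 := by gcongr
        _ = k.factorial * (exp (-x) * x ^ k / k.factorial) := by field_simp
    have := sum_le_sum this
    simpa [cdf] using this
  have hT : 1 - cdf k x ≤ 1 := by linarith [cdf_pos k hx0]
  have hT0 := one_sub_cdf_pos k hx0
  have hq : 0 < √x := sqrt_pos.2 hx0
  rw [exp_logRatio k hx0, div_le_div_iff₀ (by positivity) hq]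
  calc cdf k x * (1 - cdf k x) * √x ≤ (k + 1) * (k.factorial * weight k x) * 1 * √x := by
        gcongr
    _ = (k + 1) * k.factorial * (weight k x * √x) := by ring

/-- If the ratio exceeded `√(2/e)` somewhere, it would have an interior maximum above that value
on a compact interval, because it tends to `0` at both ends of `(0, ∞)`. -/
theorem exp_logRatio_sq_le (k : ℕ) {x : ℝ} (hx : 0 < x) :
    exp (logRatio k x) ^ 2 ≤ 2 / exp 1 := by
  set G := exp (logRatio k x) with hG
  have hGpos : 0 < G := exp_pos _
  obtain ⟨a, ha0, hax, ha⟩ : ∃ a, 0 < a ∧ a < x ∧ √a * exp a < G := by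
    have hc : ContinuousAt (fun a => √a * exp a) 0 := by fun_prop
    have h1 : ∀ᶠ a in nhdsWithin (0 : ℝ) (Set.Ioi 0), √a * exp a < G :=
      (hc.tendsto.eventually (gt_mem_nhds (by simpa using hGpos))).filter_mono nhdsWithin_le_nhds
    have h2 : ∀ᶠ a in nhdsWithin (0 : ℝ) (Set.Ioi 0), a ∈ Set.Ioo 0 x := Ioo_mem_nhdsGT hx
    obtain ⟨a, h, h'⟩ := (h1.and h2).exists
    exact ⟨a, h'.1, h'.2, h⟩
  obtain ⟨b, hb1, hxb, hb⟩ : ∃ b, 1 ≤ b ∧ x < b ∧ (k + 1) * k.factorial / √b < G := by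
    have h1 : ∀ᶠ b in Filter.atTop, ((k : ℝ) + 1) * k.factorial / √b < G :=
      (tendsto_sqrt_atTop.const_div_atTop _).eventually (gt_mem_nhds hGpos)
    obtain ⟨b, h, h', h''⟩ :=
      (h1.and ((Filter.eventually_ge_atTop 1).and (Filter.eventually_gt_atTop x))).exists
    exact ⟨b, h', h'', h⟩
  have hcont : ContinuousOn (logRatio k) (Set.Icc a b) := fun y hy =>
    (hasDerivAt_logRatio k (ha0.trans_le hy.1)).continuousAt.continuousWithinAt
  obtain ⟨c, hc, hmax⟩ := isCompact_Icc.exists_isMaxOn ⟨x, hax.le, hxb.le⟩ hcont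
  have hGc : G ≤ exp (logRatio k c) := exp_le_exp.2 (hmax ⟨hax.le, hxb.le⟩)
  have hc0 : 0 < c := ha0.trans_le hc.1
  have hca : c ≠ a := by
    rintro rfl
    linarith [exp_logRatio_le_sqrt_mul_exp k hc0]
  have hcb : c ≠ b := by
    rintro rfl
    linarith [exp_logRatio_le_div_sqrt k hb1]
  have hloc : IsLocalMax (logRatio k) c := hmax.isLocalMax
    (Icc_mem_nhds (lt_of_le_of_ne hc.1 hca.symm) (lt_of_le_of_ne hc.2 hcb))
  have hcrit := exp_logRatio_sq_le_of_critical k hc0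
    (hloc.hasDerivAt_eq_zero (hasDerivAt_logRatio k hc0))
  exact (by gcongr : G ^ 2 ≤ exp (logRatio k c) ^ 2).trans hcrit

theorem cdf_mul_one_sub_cdf_le (k : ℕ) {x : ℝ} (hx : 0 < x) (hx1 : x ≤ 1) :
    cdf k x * (1 - cdf k x) ≤ x * weight k x := by
  obtain ⟨t, h0, h1, h⟩ := exists_one_sub_cdf_eq k hx
  have hS : cdf k x ≤ 1 := by linarith [one_sub_cdf_pos k hx]
  have hS0 := cdf_pos k hx
  have hw := weight_pos k hx
  rw [h]
  rcases k with _ | k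
  · have hS' : cdf 0 x = weight 0 x := by simp [cdf]
    have : weight 0 t ≤ 1 := by
      simpa [weight] using h0.le
    rw [hS']
    calc weight 0 x * (x * weight 0 t) ≤ weight 0 x * (x * 1) := by gcongr
      _ = x * weight 0 x := by ring
  · -- `s ↦ s e⁻ˢ` is increasing on `[0, 1]`
    have hmono : exp (-t) * t ≤ exp (-x) * x := by
      have h2 : exp (-(x - t)) ≥ 1 - (x - t) := by linarith [add_one_le_exp (-(x - t))]
      have h3 : t ≤ exp (-(x - t)) * x := by nlinarith
      calc exp (-t) * t ≤ exp (-t) * (exp (-(x - t)) * x) := by gcongr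
        _ = exp (-x) * x := by rw [← mul_assoc, ← exp_add]; ring_nf
    have hle : weight (k + 1) t ≤ weight (k + 1) x := by
      unfold weight
      rw [pow_succ', pow_succ', ← mul_assoc, ← mul_assoc]
      gcongr
    calc cdf (k + 1) x * (x * weight (k + 1) t) ≤ 1 * (x * weight (k + 1) x) := by
          gcongr
          exact mul_nonneg hx.le (weight_pos _ h0).le
      _ = _ := by ring

/-- The supremum norm bound for solutions of the Stein–Chen equation, in terms of Poisson
probabilities. -/
theorem cdf_mul_one_sub_cdf_div_le (k : ℕ) {x : ℝ} (hx : 0 < x) :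
    cdf k x * (1 - cdf k x) / (x * weight k x) ≤ min 1 √(2 / (exp 1 * x)) := by
  have hw := weight_pos k hx
  have hq : 0 < √x := sqrt_pos.2 hx
  have hqx : √x * √x = x := mul_self_sqrt hx.le
  have hsqrt : cdf k x * (1 - cdf k x) / (x * weight k x) ≤ √(2 / (exp 1 * x)) := by
    have h : cdf k x * (1 - cdf k x) / (x * weight k x) = exp (logRatio k x) / √x := by
      rw [exp_logRatio k hx, div_div]
      congr 1
      linear_combination (-weight k x) * hqx
    rw [h]
    apply le_sqrt_of_sq_le
    rw [div_pow, sq_sqrt hx.le, ← div_div]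
    gcongr
    exact exp_logRatio_sq_le k hx
  refine le_min ?_ hsqrt
  rcases le_total x 1 with h | h
  · rw [div_le_one (by positivity)]
    exact cdf_mul_one_sub_cdf_le k hx h
  · refine hsqrt.trans ?_
    rw [sqrt_le_one, div_le_one (by positivity)]
    nlinarith [exp_one_gt_d9]

end SteinChen

/-! ### The Stein–Chen equation -/

namespace SteinChen

open Real Finset

theorem mul_cdf_le (k : ℕ) {x : ℝ} (hx : 0 < x) :
    x * cdf k x ≤ (k + 1) * (cdf (k + 1) x - weight 0 x) := by
  have h : cdf (k + 1) x - weight 0 x = ∑ i ∈ range (k + 1), weight (i + 1) x := by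
    rw [cdf, sum_range_succ']; ring
  rw [h, cdf, mul_sum, mul_sum]
  refine sum_le_sum fun i hi => ?_
  have hik : (i : ℝ) ≤ k := by
    exact_mod_cast Nat.lt_succ_iff.1 (mem_range.1 hi)
  have hw := weight_pos (i + 1) hx
  rw [← succ_mul_weight_succ]
  gcongr

/-- The left-hand side and the right-hand side agree at `x = 0`, and their difference has
derivative `1 - cdf k x`. -/
theorem succ_mul_one_sub_cdf_succ_le (k : ℕ) {x : ℝ} (hx : 0 < x) :
    (k + 1) * (1 - cdf (k + 1) x) ≤ x * (1 - cdf k x) := by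
  have hd : ∀ y, HasDerivAt (fun y => y * (1 - cdf k y) - (k + 1) * (1 - cdf (k + 1) y))
      (1 - cdf k y) y := fun y => by
    refine (((hasDerivAt_id y).mul ((hasDerivAt_cdf k y).const_sub 1)).sub
      (((hasDerivAt_cdf (k + 1) y).const_sub 1).const_mul ((k : ℝ) + 1))).congr_deriv ?_
    have := succ_mul_weight_succ k y
    simp only [id]
    linarith
  obtain ⟨t, ht, h⟩ := exists_hasDerivAt_eq_slope _ _ hx
    (fun y _ => (hd y).continuousAt.continuousWithinAt) (fun y _ => hd y)
  have hpos := one_sub_cdf_pos k ht.1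
  rw [h] at hpos
  simp only [cdf_apply_zero, sub_self, mul_zero, sub_zero] at hpos
  have := (div_pos_iff_of_pos_right hx).1 hpos
  linarith

theorem poissonMeasure_real_singleton_eq (lam : ℝ≥0) (k : ℕ) :
    (poissonMeasure lam).real {k} = weight k lam := poissonMeasure_real_singleton lam k

theorem poissonMeasure_real_Iic (lam : ℝ≥0) (k : ℕ) :
    (poissonMeasure lam).real (Set.Iic k) = cdf k lam := by
  have : Set.Iic k = ((range (k + 1) : Finset ℕ) : Set ℕ) := by
    ext i; simp
  rw [this, ← sum_measureReal_singleton]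
  simp only [poissonMeasure_real_singleton_eq, cdf]

/-- The value at `k + 1` of the solution of the Stein–Chen equation
`λ g(k + 1) - k g(k) = 1_A(k) - Po(λ)(A)`. -/
noncomputable def solAux (lam : ℝ≥0) (A : Set ℕ) (k : ℕ) : ℝ :=
  ((poissonMeasure lam).real (A ∩ Set.Iic k)
    - (poissonMeasure lam).real A * cdf k lam) / (lam * weight k lam)

/-- The solution of the Stein–Chen equation `λ g(k + 1) - k g(k) = 1_A(k) - Po(λ)(A)`. The
equation does not determine `g 0`; the choice `g 0 = g 1` makes the first increment vanish. -/
noncomputable def sol (lam : ℝ≥0) (A : Set ℕ) : ℕ → ℝ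
  | 0 => solAux lam A 0
  | k + 1 => solAux lam A k

variable {lam : ℝ≥0}

theorem measureReal_inter_Iic_succ (A : Set ℕ) (k : ℕ) :
    (poissonMeasure lam).real (A ∩ Set.Iic (k + 1)) =
      (poissonMeasure lam).real (A ∩ Set.Iic k) + A.indicator 1 (k + 1) * weight (k + 1) lam := by
  have h : A ∩ Set.Iic (k + 1) = (A ∩ Set.Iic k) ∪ (A ∩ {k + 1}) := by
    rw [← Set.inter_union_distrib_left]
    congr 1
    ext i
    simp only [Set.mem_Iic, Set.mem_union, Set.mem_singleton_iff]
    omega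
  rw [h, measureReal_union _ (MeasurableSet.of_discrete)]
  · by_cases hA : k + 1 ∈ A
    · have : A ∩ {k + 1} = {k + 1} := by simpa using hA
      simp [this, hA, poissonMeasure_real_singleton_eq]
    · have : A ∩ {k + 1} = ∅ := by simpa using hA
      simp [this, hA]
  · rw [Set.disjoint_left]
    rintro i ⟨-, hi⟩ ⟨-, hi'⟩
    simp only [Set.mem_Iic, Set.mem_singleton_iff] at hi hi'
    omega

theorem sol_equation (hlam : 0 < lam) (A : Set ℕ) (k : ℕ) :
    lam * sol lam A (k + 1) - k * sol lam A k =
      A.indicator 1 k - (poissonMeasure lam).real A := by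
  have hl : (0 : ℝ) < lam := hlam
  rcases k with _ | k
  · have hw := weight_pos 0 hl
    have h0 : (poissonMeasure lam).real (A ∩ Set.Iic 0) = A.indicator 1 0 * weight 0 lam := by
      have hI : Set.Iic 0 = ({0} : Set ℕ) := by ext i; simp
      rw [hI]
      by_cases hA : 0 ∈ A
      · have : A ∩ {0} = {0} := by simpa using hA
        simp [this, hA, poissonMeasure_real_singleton_eq]
      · have : A ∩ {0} = ∅ := by simpa using hA
        simp [this, hA]
    have hS : cdf 0 lam = weight 0 lam := by simp [cdf]
    simp only [sol, solAux, h0, hS]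
    field_simp
    simp [mul_comm]
  · have hw := weight_pos k hl
    have hw' := weight_pos (k + 1) hl
    have h1 := succ_mul_weight_succ k lam
    have hS : cdf (k + 1) lam = cdf k lam + weight (k + 1) lam := by
      simp [cdf, sum_range_succ _ (k + 1)]
    simp only [sol, solAux, measureReal_inter_Iic_succ, hS, ← h1]
    push_cast
    field_simp
    ring

theorem abs_solAux_le (hlam : 0 < lam) (A : Set ℕ) (k : ℕ) :
    |solAux lam A k| ≤ min 1 √(2 / (exp 1 * lam)) := by
  have hl : (0 : ℝ) < lam := hlam
  have hw := weight_pos k hl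
  have hS := cdf_pos k hl
  have hT := one_sub_cdf_pos k hl
  refine le_trans ?_ (cdf_mul_one_sub_cdf_div_le k hl)
  rw [solAux, abs_div, abs_of_pos (mul_pos hl hw)]
  gcongr
  have hA := measureReal_inter_add_sdiff (s := A) (μ := poissonMeasure lam)
    (MeasurableSet.of_discrete (s := Set.Iic k))
  have hu : (poissonMeasure lam).real (A ∩ Set.Iic k) ≤ cdf k lam := by
    rw [← poissonMeasure_real_Iic]
    exact measureReal_mono Set.inter_subset_right
  have hv : (poissonMeasure lam).real (A \ Set.Iic k) ≤ 1 - cdf k lam := by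
    rw [← poissonMeasure_real_Iic, ← probReal_compl_eq_one_sub MeasurableSet.of_discrete]
    exact measureReal_mono (fun i hi => hi.2)
  have hu0 := measureReal_nonneg (μ := poissonMeasure lam) (s := A ∩ Set.Iic k)
  have hv0 := measureReal_nonneg (μ := poissonMeasure lam) (s := A \ Set.Iic k)
  rw [← hA, abs_le]
  constructor <;> nlinarith

/-- The numerator of `g(k + 1)` is `Po(A ∩ [0,k]) Po([0,k]ᶜ) - Po(A \ [0,k]) Po([0,k])`. Both
`Po([0,k]) / Po{k}` and `-Po([0,k]ᶜ) / Po{k}` increase with `k`, so an increment of `g` can be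
positive only through the contribution of the point `k + 1 ∈ A`. -/
theorem solAux_succ_sub_le (hlam : 0 < lam) (A : Set ℕ) (k : ℕ) :
    solAux lam A (k + 1) - solAux lam A k ≤ (1 - exp (-lam)) / lam := by
  have hl : (0 : ℝ) < lam := hlam
  have hw := weight_pos k hl
  have hw' := weight_pos (k + 1) hl
  have hww := succ_mul_weight_succ k lam
  have hk : (0 : ℝ) < k + 1 := by positivity
  have hS := mul_cdf_le k hl
  have hw0 : weight 0 lam = exp (-lam) := by simp [weight]
  have hw0' : 0 < weight 0 lam := weight_pos 0 hl
  have hT := succ_mul_one_sub_cdf_succ_le k hl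
  have hS' : cdf (k + 1) lam = cdf k lam + weight (k + 1) lam := by
    simp [cdf, sum_range_succ _ (k + 1)]
  have hA := measureReal_inter_add_sdiff (s := A) (μ := poissonMeasure lam)
    (MeasurableSet.of_discrete (s := Set.Iic (k + 1)))
  have hu0 := measureReal_nonneg (μ := poissonMeasure lam) (s := A ∩ Set.Iic k)
  have hv0 := measureReal_nonneg (μ := poissonMeasure lam) (s := A \ Set.Iic (k + 1))
  have he : A.indicator 1 (k + 1) ∈ Set.Icc (0 : ℝ) 1 := by
    by_cases h : k + 1 ∈ A <;> simp [h]
  have hu' := measureReal_inter_Iic_succ (lam := lam) A k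
  have hcdf := cdf_pos k hl
  have htail := one_sub_cdf_pos (k + 1) hl
  rw [← hw0]
  unfold solAux
  rw [← hA, hu']
  set u := (poissonMeasure lam).real (A ∩ Set.Iic k)
  set v := (poissonMeasure lam).real (A \ Set.Iic (k + 1))
  set e : ℝ := A.indicator 1 (k + 1)
  set S := cdf k lam
  set S' := cdf (k + 1) lam
  set w := weight k lam
  set w' := weight (k + 1) lam
  have h1 : (u + e * w' - (u + e * w' + v) * S') / (lam * w')
      - (u - (u + e * w' + v) * S) / (lam * w)
      = u * ((1 - S') / (lam * w') - (1 - S) / (lam * w))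
        + v * (S / (lam * w) - S' / (lam * w'))
        + e * ((1 - S') / lam + S * w' / (lam * w)) := by
    field_simp
    ring
  have h2 : (1 - S') / (lam * w') - (1 - S) / (lam * w) ≤ 0 := by
    rw [sub_nonpos, div_le_div_iff₀ (by positivity) (by positivity)]
    have : (1 - S') * w ≤ (1 - S) * w' := by
      rw [← mul_le_mul_iff_right₀ hk]
      calc ((k : ℝ) + 1) * ((1 - S') * w) = ((k + 1) * (1 - S')) * w := by ring
        _ ≤ lam * (1 - S) * w := by gcongr
        _ = (k + 1) * ((1 - S) * w') := by linear_combination (-(1 - S)) * hww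
    nlinarith
  have h3 : S / (lam * w) - S' / (lam * w') ≤ 0 := by
    rw [sub_nonpos, div_le_div_iff₀ (by positivity) (by positivity)]
    have : S * w' ≤ S' * w := by
      rw [← mul_le_mul_iff_right₀ hk]
      calc ((k : ℝ) + 1) * (S * w') = lam * S * w := by linear_combination S * hww
        _ ≤ (k + 1) * (S' - weight 0 lam) * w := by gcongr
        _ ≤ (k + 1) * S' * w := by gcongr; linarith
        _ = (k + 1) * (S' * w) := by ring
    nlinarith
  have h4 : (1 - S') / lam + S * w' / (lam * w) ≤ (1 - weight 0 lam) / lam := by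
    have : S * w' / (lam * w) ≤ (S' - weight 0 lam) / lam := by
      rw [div_le_div_iff₀ (by positivity) hl]
      have h5 : w' * (k + 1) = lam * w := by linarith
      rw [← mul_le_mul_iff_right₀ hk]
      calc ((k : ℝ) + 1) * (S * w' * lam) = (lam * S) * (lam * w) := by rw [← h5]; ring
        _ ≤ ((k + 1) * (S' - weight 0 lam)) * (lam * w) := by gcongr
        _ = (k + 1) * ((S' - weight 0 lam) * (lam * w)) := by ring
    calc (1 - S') / lam + S * w' / (lam * w)
        ≤ (1 - S') / lam + (S' - weight 0 lam) / lam := by gcongr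
      _ = (1 - weight 0 lam) / lam := by ring
  have h5 : 0 ≤ (1 - S') / lam + S * w' / (lam * w) := by positivity
  rw [h1]
  calc _ ≤ 0 + 0 + 1 * ((1 - S') / lam + S * w' / (lam * w)) := by
        gcongr
        · exact mul_nonpos_of_nonneg_of_nonpos hu0 h2
        · exact mul_nonpos_of_nonneg_of_nonpos hv0 h3
        · exact he.2
    _ ≤ _ := by linarith

theorem solAux_compl (A : Set ℕ) (k : ℕ) : solAux lam Aᶜ k = -solAux lam A k := by
  have h : (poissonMeasure lam).real (Aᶜ ∩ Set.Iic k)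
      = cdf k lam - (poissonMeasure lam).real (A ∩ Set.Iic k) := by
    rw [← poissonMeasure_real_Iic]
    have := measureReal_inter_add_sdiff (μ := poissonMeasure lam)
      (s := Set.Iic k) (MeasurableSet.of_discrete (s := A))
    rw [Set.inter_comm Aᶜ, ← Set.sdiff_eq, Set.inter_comm A]
    linarith
  rw [solAux, solAux, h, probReal_compl_eq_one_sub MeasurableSet.of_discrete]
  ring

theorem abs_sol_le (hlam : 0 < lam) (A : Set ℕ) (k : ℕ) :
    |sol lam A k| ≤ min 1 √(2 / (exp 1 * lam)) := by
  rcases k with _ | k <;> exact abs_solAux_le hlam A _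

theorem abs_sol_succ_sub_le (hlam : 0 < lam) (A : Set ℕ) (k : ℕ) :
    |sol lam A (k + 1) - sol lam A k| ≤ (1 - exp (-lam)) / lam := by
  rcases k with _ | k
  · have : exp (-lam) ≤ 1 := by simp
    simp only [sol, sub_self, abs_zero]
    exact div_nonneg (by linarith) lam.2
  · have h1 := solAux_succ_sub_le hlam A k
    have h2 := solAux_succ_sub_le hlam Aᶜ k
    rw [solAux_compl, solAux_compl] at h2
    exact abs_le.2 ⟨by simp only [sol]; linarith, h1⟩

/-- Comparison of an increment of `g` over `n` steps with `n` times a weighted mean of the two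
one-step increments at the end points. -/
theorem abs_increment_sub_le_nat {g : ℕ → ℝ} {M : ℝ} (hM : ∀ k, |g (k + 1) - g k| ≤ M)
    {p q : ℝ} (hp : 0 ≤ p) (hpq : p + q = 1) (b n : ℕ) :
    |n * (p * (g (b + n + 1) - g (b + n)) + q * (g (b + 1) - g b)) - (g (b + n) - g b)| ≤
      M * (n ^ 2 + (p - q) * n) := by
  have hM0 : 0 ≤ M := (abs_nonneg _).trans (hM 0)
  rcases n with _ | n
  · simp
  have h1 := hM (b + (n + 1))
  have h2 := hM b
  have h3 : |g (b + (n + 1)) - g (b + 1)| ≤ n * M := by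
    induction n with
    | zero => simp
    | succ n ih =>
      have := hM (b + (n + 1))
      calc |g (b + (n + 1 + 1)) - g (b + 1)|
          = |(g (b + (n + 1) + 1) - g (b + (n + 1))) + (g (b + (n + 1)) - g (b + 1))| := by
            rw [← add_assoc b (n + 1) 1]; ring_nf
        _ ≤ M + n * M := (abs_add_le _ _).trans (by gcongr; exact ih (hM _))
        _ = _ := by push_cast; ring
  set x := g (b + (n + 1) + 1) - g (b + (n + 1))
  set y := g (b + 1) - g b
  have hn : (0 : ℝ) ≤ n := by positivity
  have hsplit : ((n + 1 : ℕ) : ℝ) * (p * x + q * y) - (g (b + (n + 1)) - g b)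
      = ((n + 1) * p) * x + ((n + 1) * q - 1) * y - (g (b + (n + 1)) - g (b + 1)) := by
    push_cast; simp only [y]; ring
  have hcoef : ((n : ℝ) + 1) * p + |(n + 1) * q - 1| + n ≤ (n + 1) ^ 2 + (p - q) * (n + 1) := by
    obtain rfl : p = 1 - q := by linarith
    have hnat : (0 : ℝ) ≤ n * (n - 1) := by
      rcases n with _ | n
      · simp
      · push_cast; nlinarith
    -- with `N = n + 1`, the slack is at least `(N - 1) (N - 2)` if `N q ≥ 1`, else `N (N - 1)`
    rcases abs_cases (((n : ℝ) + 1) * q - 1) with ⟨h, -⟩ | ⟨h, -⟩ <;> rw [h] <;> nlinarith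
  rw [hsplit]
  calc _ ≤ |((n + 1) * p) * x| + |((n + 1) * q - 1) * y| + |g (b + (n + 1)) - g (b + 1)| :=
        (abs_sub _ _).trans (by gcongr; exact abs_add_le _ _)
    _ ≤ ((n + 1) * p) * M + |(n + 1) * q - 1| * M + n * M := by
        rw [abs_mul (_ * p), abs_mul (_ - 1), abs_of_nonneg (by positivity : 0 ≤ ((n : ℝ) + 1) * p)]
        gcongr
    _ = M * ((n + 1) * p + |(n + 1) * q - 1| + n) := by ring
    _ ≤ M * ((n + 1) ^ 2 + (p - q) * (n + 1)) := by gcongr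
    _ = _ := by push_cast; ring

theorem abs_increment_sub_le {g : ℕ → ℝ} {M : ℝ} (hM : ∀ k, |g (k + 1) - g k| ≤ M)
    {p q : ℝ} (hp : 0 ≤ p) (hq : 0 ≤ q) (hpq : p + q = 1) (a b : ℕ) :
    |((a : ℝ) - b) * (p * (g (a + 1) - g a) + q * (g (b + 1) - g b)) - (g a - g b)| ≤
      M * (((a : ℝ) - b) ^ 2 + (p - q) * (a - b)) := by
  rcases le_total b a with h | h
  · obtain ⟨n, rfl⟩ := Nat.exists_eq_add_of_le h
    convert! abs_increment_sub_le_nat hM hp hpq b n using 2 <;> push_cast <;> ring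
  · obtain ⟨n, rfl⟩ := Nat.exists_eq_add_of_le h
    rw [← abs_neg]
    convert! abs_increment_sub_le_nat hM hq ((add_comm q p).trans hpq) a n using 2 <;> push_cast <;> ring

end SteinChen

/-! ### Resampling one coordinate of the product law -/

namespace Rademacher

variable (p : ℕ → Set.Ioo (0 : ℝ) 1)

theorem q_pos (k : ℕ) : 0 < q p k := sub_pos.2 (p k).2.2

theorem p_add_q (k : ℕ) : (p k : ℝ) + q p k = 1 := by simp [q]

theorem s_pos (k : ℕ) : 0 < s p k := Real.sqrt_pos.2 (mul_pos (p k).2.1 (q_pos p k))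

theorem s_mul_s (k : ℕ) : s p k * s p k = p k * q p k :=
  Real.mul_self_sqrt (mul_pos (p k).2.1 (q_pos p k)).le

theorem preimage_update_pi {S : Finset ℕ} {k : ℕ} (hk : k ∈ S) (t : ℕ → Set ℤˣ) (u : ℤˣ) :
    (fun ω : Space => Function.update ω k u) ⁻¹' (S : Set ℕ).pi t =
      {_ω | u ∈ t k} ∩ ((S.erase k : Finset ℕ) : Set ℕ).pi t := by
  ext ω
  simp only [Set.mem_preimage, Set.mem_pi, Set.mem_inter_iff, Set.mem_ofPred_eq, Finset.mem_coe,
    Finset.mem_erase]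
  constructor
  · intro h
    refine ⟨by simpa using h k hk, fun i hi => ?_⟩
    simpa [Function.update_of_ne hi.1] using h i hi.2
  · rintro ⟨h, h'⟩ i hi
    by_cases hik : i = k
    · subst hik; simpa using h
    · simpa [Function.update_of_ne hik] using h' i ⟨hik, hi⟩

theorem preimage_update_pi_of_notMem {S : Finset ℕ} {k : ℕ} (hk : k ∉ S) (t : ℕ → Set ℤˣ)
    (u : ℤˣ) : (fun ω : Space => Function.update ω k u) ⁻¹' (S : Set ℕ).pi t = (S : Set ℕ).pi t := by
  ext ω
  simp only [Set.mem_preimage, Set.mem_pi, Finset.mem_coe]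
  refine forall₂_congr fun i hi => ?_
  rw [Function.update_of_ne (by rintro rfl; exact hk hi)]

/-- The product law is invariant under resampling of the `k`-th coordinate. -/
theorem law_eq_resample (k : ℕ) :
    law p = ENNReal.ofReal (p k) • (law p).map (fun ω => Function.update ω k 1)
      + ENNReal.ofReal (q p k) • (law p).map (fun ω => Function.update ω k (-1)) := by
  symm
  refine Measure.eq_infinitePi _ fun S t ht => ?_
  have hm : MeasurableSet ((S : Set ℕ).pi t) := .pi S.countable_toSet fun i _ => ht i
  rw [Measure.add_apply, Measure.smul_apply, Measure.smul_apply,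
    Measure.map_apply measurable_update_left hm, Measure.map_apply measurable_update_left hm]
  by_cases hk : k ∈ S
  · rw [preimage_update_pi hk, preimage_update_pi hk, ← Finset.mul_prod_erase S _ hk,
      ← Measure.infinitePi_pi (fun k => coordLaw (p k)) fun i _ => ht i]
    have h (u : ℤˣ) : law p ({_ω | u ∈ t k} ∩ ((S.erase k : Finset ℕ) : Set ℕ).pi t)
        = (t k).indicator 1 u *
          Measure.infinitePi (fun k => coordLaw (p k)) (((S.erase k : Finset ℕ) : Set ℕ).pi t) := by
      by_cases hu : u ∈ t k <;> simp [hu, law]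
    rw [h, h, coordLaw, Measure.add_apply, Measure.smul_apply, Measure.smul_apply,
      Measure.dirac_apply' _ (ht k), Measure.dirac_apply' _ (ht k), q]
    simp only [smul_eq_mul]
    ring
  · rw [preimage_update_pi_of_notMem hk, preimage_update_pi_of_notMem hk, ← add_smul,
      ← ENNReal.ofReal_add (p k).2.1.le (q_pos p k).le, p_add_q, ENNReal.ofReal_one, one_smul, law,
      Measure.infinitePi_pi (fun k => coordLaw (p k)) fun i _ => ht i]

theorem absolutelyContinuous_map_update (k : ℕ) (u : ℤˣ) :
    (law p).map (fun ω => Function.update ω k u) ≪ law p := by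
  have h1 : ENNReal.ofReal (p k) ≠ 0 := (ENNReal.ofReal_pos.2 (p k).2.1).ne'
  have h2 : ENNReal.ofReal (q p k) ≠ 0 := (ENNReal.ofReal_pos.2 (q_pos p k)).ne'
  refine Measure.AbsolutelyContinuous.mk fun A _ hA => ?_
  rw [law_eq_resample p k] at hA
  simp only [Measure.add_apply, Measure.smul_apply, smul_eq_mul, add_eq_zero, mul_eq_zero, h1,
    h2, false_or] at hA
  rcases Int.units_eq_one_or u with rfl | rfl
  exacts [hA.1, hA.2]

theorem ae_update {P : Space → Prop} (h : ∀ᵐ ω ∂(law p), P ω) (k : ℕ) (u : ℤˣ) :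
    ∀ᵐ ω ∂(law p), P (Function.update ω k u) :=
  ae_of_ae_map measurable_update_left.aemeasurable ((absolutelyContinuous_map_update p k u).ae_le h)

variable {p}

theorem integrable_update {h : Space → ℝ} (hh : Integrable h (law p)) (k : ℕ) (u : ℤˣ) :
    Integrable (fun ω => h (Function.update ω k u)) (law p) := by
  have h1 : ENNReal.ofReal (p k) ≠ 0 := (ENNReal.ofReal_pos.2 (p k).2.1).ne'
  have h2 : ENNReal.ofReal (q p k) ≠ 0 := (ENNReal.ofReal_pos.2 (q_pos p k)).ne'
  rw [law_eq_resample p k, integrable_add_measure,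
    integrable_smul_measure h1 ENNReal.ofReal_ne_top,
    integrable_smul_measure h2 ENNReal.ofReal_ne_top] at hh
  rcases Int.units_eq_one_or u with rfl | rfl
  exacts [hh.1.comp_measurable measurable_update_left, hh.2.comp_measurable measurable_update_left]

theorem integral_eq_resample {h : Space → ℝ} (hh : Integrable h (law p)) (k : ℕ) :
    ∫ ω, h ω ∂(law p) = p k * ∫ ω, h (Function.update ω k 1) ∂(law p)
      + q p k * ∫ ω, h (Function.update ω k (-1)) ∂(law p) := by
  have hm (u : ℤˣ) : AEMeasurable (fun ω : Space => Function.update ω k u) (law p) :=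
    measurable_update_left.aemeasurable
  have h' := hh
  rw [law_eq_resample p k, integrable_add_measure] at h'
  have hs (u : ℤˣ) : AEStronglyMeasurable h ((law p).map fun ω => Function.update ω k u) :=
    hh.1.mono_ac (absolutelyContinuous_map_update p k u)
  conv_lhs => rw [law_eq_resample p k]
  rw [integral_add_measure h'.1 h'.2, integral_smul_measure, integral_smul_measure,
    integral_map (hm _) (hs _), integral_map (hm _) (hs _),
    ENNReal.toReal_ofReal (p k).2.1.le, ENNReal.toReal_ofReal (q_pos p k).le]
  rfl

theorem Y_update_one (k : ℕ) (ω : Space) : Y p k (Function.update ω k 1) = q p k / s p k := by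
  have := s_pos p k
  simp only [Y, X, Function.update_self, q]
  push_cast
  field_simp
  ring

theorem Y_update_neg_one (k : ℕ) (ω : Space) :
    Y p k (Function.update ω k (-1)) = -(p k / s p k) := by
  have := s_pos p k
  simp only [Y, X, Function.update_self, q]
  push_cast
  field_simp
  ring

theorem Y_update_of_ne {j k : ℕ} (h : j ≠ k) (u : ℤˣ) (ω : Space) :
    Y p j (Function.update ω k u) = Y p j ω := by
  simp [Y, X, Function.update_of_ne h]

theorem abs_Y_le (k : ℕ) (ω : Space) : |Y p k ω| ≤ (s p k)⁻¹ := by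
  have hs := s_pos p k
  have h1 := (p k).2.1
  have h2 := q_pos p k
  have h3 := p_add_q p k
  rw [← Function.update_eq_self k ω]
  rcases Int.units_eq_one_or (ω k) with h | h <;> rw [h]
  · rw [Y_update_one, abs_of_pos (by positivity), div_eq_mul_inv]
    exact mul_le_of_le_one_left (by positivity) (by linarith)
  · rw [Y_update_neg_one, abs_neg, abs_of_pos (by positivity), div_eq_mul_inv]
    exact mul_le_of_le_one_left (by positivity) (by linarith)

theorem integrable_Y_mul {h : Space → ℝ} (hh : Integrable h (law p)) (k : ℕ) :
    Integrable (fun ω => Y p k ω * h ω) (law p) :=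
  hh.bdd_mul (memLp_Y p k).1 (ae_of_all _ fun ω => abs_Y_le k ω)

/-- Integration by parts in the `k`-th coordinate. -/
theorem integral_Y_mul {h : Space → ℝ} (hh : Integrable h (law p)) (k : ℕ) :
    ∫ ω, Y p k ω * h ω ∂(law p) = s p k * (∫ ω, h (Function.update ω k 1) ∂(law p)
      - ∫ ω, h (Function.update ω k (-1)) ∂(law p)) := by
  have hs := s_pos p k
  rw [integral_eq_resample (integrable_Y_mul hh k) k]
  simp only [Y_update_one, Y_update_neg_one, integral_const_mul]
  field_simp
  linear_combination (∫ ω, h (Function.update ω k (-1)) ∂(law p)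
    - ∫ ω, h (Function.update ω k 1) ∂(law p)) * s_mul_s p k

theorem integrable_Y (k : ℕ) : Integrable (Y p k) (law p) :=
  (memLp_Y p k).integrable one_le_two

theorem inner_toLp {u v : Space → ℝ} (hu : MemLp u 2 (law p)) (hv : MemLp v 2 (law p)) :
    inner ℝ (hu.toLp u) (hv.toLp v) = ∫ ω, u ω * v ω ∂(law p) := by
  rw [L2.inner_def]
  refine integral_congr_ae ?_
  filter_upwards [hu.coeFn_toLp, hv.coeFn_toLp] with ω h1 h2
  rw [h1, h2, Real.inner_apply]

theorem orthonormal_Y : Orthonormal ℝ fun k => (memLp_Y p k).toLp (Y p k) := by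
  rw [orthonormal_iff_ite]
  intro j k
  rw [inner_toLp, integral_Y_mul (integrable_Y k)]
  have hs := s_pos p j
  by_cases h : j = k
  · subst h
    simp only [Y_update_one, Y_update_neg_one, integral_const, probReal_univ, one_smul, if_true]
    field_simp
    linarith [p_add_q p j]
  · simp [Y_update_of_ne (Ne.symm h), h]

theorem J₁_eq_linearIsometry (f : lp (fun _ : ℕ => ℝ) 2) :
    J₁ p f = (orthonormal_Y (p := p)).orthogonalFamily.linearIsometry f := by
  rw [OrthogonalFamily.linearIsometry_apply]
  simp [J₁]

theorem norm_J₁ (f : lp (fun _ : ℕ => ℝ) 2) : ‖J₁ p f‖ = ‖f‖ := by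
  rw [J₁_eq_linearIsometry, LinearIsometry.norm_map]

theorem hasSum_J₁ (f : lp (fun _ : ℕ => ℝ) 2) :
    HasSum (fun k => f k • (memLp_Y p k).toLp (Y p k)) (J₁ p f) := by
  rw [J₁_eq_linearIsometry]
  simpa using (orthonormal_Y (p := p)).orthogonalFamily.hasSum_linearIsometry f

theorem hasSum_sq (f : lp (fun _ : ℕ => ℝ) 2) : HasSum (fun k => f k ^ 2) (‖f‖ ^ 2) := by
  have h := lp.hasSum_norm (p := 2) (by simp) f
  simpa using h

theorem coeFn_sum_smul_Y (f : ℕ → ℝ) (S : Finset ℕ) :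
    (∑ j ∈ S, f j • (memLp_Y p j).toLp (Y p j) : Lp ℝ 2 (law p)) =ᵐ[law p]
      fun ω => ∑ j ∈ S, f j * Y p j ω := by
  induction S using Finset.induction_on with
  | empty =>
    simp only [Finset.sum_empty]
    exact Lp.coeFn_zero ..
  | insert a S ha ih =>
    rw [Finset.sum_insert ha]
    filter_upwards [Lp.coeFn_add (f a • (memLp_Y p a).toLp (Y p a))
      (∑ j ∈ S, f j • (memLp_Y p j).toLp (Y p j)), ih,
      Lp.coeFn_smul (f a) ((memLp_Y p a).toLp (Y p a)), (memLp_Y p a).coeFn_toLp] with ω h1 h2 h3 h4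
    rw [h1, Pi.add_apply, h2, h3, Pi.smul_apply, h4, Finset.sum_insert ha, smul_eq_mul]

/-- Flipping the `k`-th coordinate changes `J₁ f` by `f k / √(p_k q_k)`: true for the partial
sums, a subsequence of which converges almost surely, and the flip preserves null sets. -/
theorem J₁_update_sub (f : lp (fun _ : ℕ => ℝ) 2) (k : ℕ) :
    ∀ᵐ ω ∂(law p), J₁ p f (Function.update ω k 1) - J₁ p f (Function.update ω k (-1))
      = f k / s p k := by
  obtain ⟨ns, hns, hlim⟩ :=
    (tendstoInMeasure_of_tendsto_Lp (hasSum_J₁ (p := p) f).tendsto_sum_nat).exists_seq_tendsto_ae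
  have hpart : ∀ᵐ ω ∂(law p), Filter.Tendsto
      (fun i => ∑ j ∈ Finset.range (ns i), f j * Y p j ω) Filter.atTop (nhds (J₁ p f ω)) := by
    have hall := ae_all_iff.2 fun n => coeFn_sum_smul_Y (p := p) (fun j => f j) (Finset.range n)
    filter_upwards [hlim, hall] with ω h1 h2
    simpa only [h2] using h1
  filter_upwards [ae_update p hpart k 1, ae_update p hpart k (-1)] with ω h1 h2
  refine tendsto_nhds_unique (h1.sub h2) (tendsto_const_nhds.congr' ?_)
  filter_upwards [Filter.eventually_gt_atTop k] with i hi
  have hki : k ∈ Finset.range (ns i) := Finset.mem_range.2 (hi.trans_le hns.le_apply)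
  rw [← Finset.sum_sub_distrib, Finset.sum_eq_single_of_mem k hki]
  · have hs := s_pos p k
    rw [Y_update_one, Y_update_neg_one]
    field_simp
    linear_combination (-f k) * p_add_q p k
  · intro j _ hj
    rw [Y_update_of_ne hj, Y_update_of_ne hj, sub_self]

end Rademacher

/-! ### Integer-valued first-order integrals -/

namespace Rademacher

variable {p : ℕ → Set.Ioo (0 : ℝ) 1} {F : Space → ℕ} {f : lp (fun _ : ℕ => ℝ) 2} {c : ℝ}

theorem update_sub_eq (hFf : ∀ᵐ ω ∂(law p), (F ω : ℝ) = c + J₁ p f ω) (k : ℕ) :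
    ∀ᵐ ω ∂(law p), (F (Function.update ω k 1) : ℝ) - F (Function.update ω k (-1))
      = f k / s p k := by
  filter_upwards [ae_update p hFf k 1, ae_update p hFf k (-1), J₁_update_sub f k] with ω h1 h2 h3
  rw [h1, h2, ← h3]
  ring

/-- The coefficients of an integer-valued first-order integral are integer multiples of the
standard deviations of the coordinates. -/
theorem exists_int_mul_s_eq (hFf : ∀ᵐ ω ∂(law p), (F ω : ℝ) = c + J₁ p f ω) (k : ℕ) :
    ∃ m : ℤ, f k = m * s p k := by
  obtain ⟨ω, h⟩ := (update_sub_eq hFf k).exists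
  refine ⟨F (Function.update ω k 1) - F (Function.update ω k (-1)), ?_⟩
  rw [eq_div_iff (s_pos p k).ne'] at h
  rw [← h]
  push_cast
  ring

theorem series_term_eq (k : ℕ) :
    1 / s p k * (|f k ^ 3| + s p k * (p k - q p k) * (f k * |f k|)) =
      1 / s p k * (f k ^ 2 + s p k * (p k - q p k) * f k) * |f k| := by
  rw [abs_pow, pow_succ, sq_abs]
  ring

theorem series_term_nonneg (hFf : ∀ᵐ ω ∂(law p), (F ω : ℝ) = c + J₁ p f ω) (k : ℕ) :
    0 ≤ 1 / s p k * (f k ^ 2 + s p k * (p k - q p k) * f k) * |f k| := by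
  have hs := s_pos p k
  obtain ⟨m, hm⟩ := exists_int_mul_s_eq hFf k
  have h1 := (p k).2.1
  have h2 := q_pos p k
  have h3 := p_add_q p k
  -- an integer `m` satisfies `m (m + t) ≥ 0` whenever `|t| < 1`
  have key : 0 ≤ (m : ℝ) * (m + (p k - q p k)) := by
    rcases lt_trichotomy m 0 with h | h | h
    · have : (m : ℝ) ≤ -1 := by exact_mod_cast Int.le_sub_one_of_lt h
      nlinarith
    · simp [h]
    · have : (1 : ℝ) ≤ m := by exact_mod_cast h
      nlinarith
  have : f k ^ 2 + s p k * (p k - q p k) * f k = s p k ^ 2 * (m * (m + (p k - q p k))) := by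
    rw [hm]; ring
  rw [this]
  positivity

theorem memLp_comp (hF : Measurable F) {g : ℕ → ℝ} {C : ℝ} (hC : ∀ k, |g k| ≤ C) :
    MemLp (fun ω => g (F ω)) 2 (law p) :=
  .of_bound (measurable_from_top.comp hF).aestronglyMeasurable C (ae_of_all _ fun _ => hC _)

theorem integrable_comp (hF : Measurable F) {g : ℕ → ℝ} {C : ℝ} (hC : ∀ k, |g k| ≤ C) :
    Integrable (fun ω => g (F ω)) (law p) :=
  (memLp_comp hF hC).integrable one_le_two

theorem abs_integral_le {h : Space → ℝ} {C : ℝ} (hC : ∀ᵐ ω ∂(law p), |h ω| ≤ C) :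
    |∫ ω, h ω ∂(law p)| ≤ C := by
  simpa using norm_integral_le_of_norm_le_const (f := h) hC

/-- Comparison, in the `k`-th coordinate, of the integration by parts term with the one-step
increment of `g`. -/
theorem abs_stein_term_le (hF : Measurable F)
    (hFf : ∀ᵐ ω ∂(law p), (F ω : ℝ) = c + J₁ p f ω) {g : ℕ → ℝ} {C M : ℝ}
    (hC : ∀ k, |g k| ≤ C) (hM : ∀ k, |g (k + 1) - g k| ≤ M) (k : ℕ) :
    |f k * (f k * ∫ ω, (g (F ω + 1) - g (F ω)) ∂(law p) - ∫ ω, Y p k ω * g (F ω) ∂(law p))| ≤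
      M * (1 / s p k * (|f k ^ 3| + s p k * (p k - q p k) * (f k * |f k|))) := by
  have hs := s_pos p k
  have hg := integrable_comp (p := p) hF hC
  have hd : Integrable (fun ω => g (F ω + 1) - g (F ω)) (law p) :=
    integrable_comp (g := fun k => g (k + 1) - g k) hF hM
  have hg1 := integrable_update hg k 1
  have hg2 := integrable_update hg k (-1)
  have hd1 := integrable_update hd k 1
  have hd2 := integrable_update hd k (-1)
  set m := f k / s p k with hm
  have hfm : f k = m * s p k := by rw [hm]; field_simp
  have hint : f k * ∫ ω, (g (F ω + 1) - g (F ω)) ∂(law p) - ∫ ω, Y p k ω * g (F ω) ∂(law p)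
      = s p k * ∫ ω, (m * (p k * (g (F (Function.update ω k 1) + 1) - g (F (Function.update ω k 1)))
        + q p k * (g (F (Function.update ω k (-1)) + 1) - g (F (Function.update ω k (-1)))))
        - (g (F (Function.update ω k 1)) - g (F (Function.update ω k (-1))))) ∂(law p) := by
    have hsum : Integrable (fun ω =>
        p k * (g (F (Function.update ω k 1) + 1) - g (F (Function.update ω k 1)))
        + q p k * (g (F (Function.update ω k (-1)) + 1) - g (F (Function.update ω k (-1)))))
        (law p) := (hd1.const_mul _).add (hd2.const_mul _)
    have hdiff : Integrable (fun ω =>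
        g (F (Function.update ω k 1)) - g (F (Function.update ω k (-1)))) (law p) := hg1.sub hg2
    rw [integral_Y_mul hg, integral_eq_resample hd k, integral_sub (hsum.const_mul m) hdiff,
      integral_const_mul, integral_add (hd1.const_mul _) (hd2.const_mul _), integral_const_mul,
      integral_const_mul, integral_sub hg1 hg2, hfm]
    ring
  have hbound : |∫ ω, (m * (p k * (g (F (Function.update ω k 1) + 1)
        - g (F (Function.update ω k 1)))
        + q p k * (g (F (Function.update ω k (-1)) + 1) - g (F (Function.update ω k (-1)))))
        - (g (F (Function.update ω k 1)) - g (F (Function.update ω k (-1))))) ∂(law p)|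
      ≤ M * (m ^ 2 + (p k - q p k) * m) := by
    refine abs_integral_le ?_
    filter_upwards [update_sub_eq hFf k] with ω hω
    rw [hm, ← hω]
    exact SteinChen.abs_increment_sub_le hM (p k).2.1.le (q_pos p k).le (p_add_q p k) _ _
  rw [hint, series_term_eq, abs_mul, abs_mul, abs_of_pos hs]
  calc _ ≤ |f k| * (s p k * (M * (m ^ 2 + (p k - q p k) * m))) := by gcongr
    _ = _ := by rw [hfm]; field_simp

/-- Expansion of the Stein–Chen functional, coordinate by coordinate. -/
theorem hasSum_stein (hF : Measurable F) (hFf : ∀ᵐ ω ∂(law p), (F ω : ℝ) = c + J₁ p f ω)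
    (lam : ℝ) {g : ℕ → ℝ} {C : ℝ} (hC : ∀ k, |g k| ≤ C) :
    HasSum (fun k => f k * (f k * ∫ ω, (g (F ω + 1) - g (F ω)) ∂(law p)
        - ∫ ω, Y p k ω * g (F ω) ∂(law p)))
      (∫ ω, (lam * g (F ω + 1) - F ω * g (F ω)) ∂(law p) - (lam - c) * ∫ ω, g (F ω) ∂(law p)
        - (lam - ‖f‖ ^ 2) * ∫ ω, (g (F ω + 1) - g (F ω)) ∂(law p)) := by
  have hgL := memLp_comp (p := p) hF hC
  have hg := integrable_comp (p := p) hF hC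
  have hg1 : Integrable (fun ω => g (F ω + 1)) (law p) :=
    integrable_comp (g := fun k => g (k + 1)) hF fun k => hC (k + 1)
  have hJ : Integrable (fun ω => J₁ p f ω * g (F ω)) (law p) :=
    (Lp.memLp (J₁ p f)).integrable_mul hgL
  have h1 : HasSum (fun k => f k * ∫ ω, Y p k ω * g (F ω) ∂(law p))
      (∫ ω, J₁ p f ω * g (F ω) ∂(law p)) := by
    have h := (innerSL ℝ (hgL.toLp _)).hasSum (hasSum_J₁ (p := p) f)
    have hlim : innerSL ℝ (hgL.toLp _) (J₁ p f) = ∫ ω, J₁ p f ω * g (F ω) ∂(law p) := by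
      rw [innerSL_apply_apply, real_inner_comm]
      conv_lhs => rw [← Lp.toLp_coeFn (J₁ p f) (Lp.memLp _)]
      exact inner_toLp (Lp.memLp _) hgL
    rw [hlim] at h
    refine h.congr_fun ?_
    intro k
    rw [innerSL_apply_apply, inner_smul_right, real_inner_comm, inner_toLp]
  have h2 := (hasSum_sq f).mul_right (∫ ω, (g (F ω + 1) - g (F ω)) ∂(law p))
  have hcJ : Integrable (fun ω => c * g (F ω) + J₁ p f ω * g (F ω)) (law p) :=
    (hg.const_mul c).add hJ
  have h3 : ∫ ω, (lam * g (F ω + 1) - F ω * g (F ω)) ∂(law p)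
      = lam * ∫ ω, g (F ω + 1) ∂(law p)
        - (c * ∫ ω, g (F ω) ∂(law p) + ∫ ω, J₁ p f ω * g (F ω) ∂(law p)) := by
    rw [← integral_const_mul, ← integral_const_mul, ← integral_add (hg.const_mul c) hJ,
      ← integral_sub (hg1.const_mul lam) hcJ]
    refine integral_congr_ae ?_
    filter_upwards [hFf] with ω h
    rw [h]
    ring
  have h := h2.sub h1
  convert! h using 1
  · ext k
    ring
  · rw [h3, integral_sub hg1 hg]
    ring

theorem variance_eq_norm_sq (hF : Measurable F)
    (hFf : ∀ᵐ ω ∂(law p), (F ω : ℝ) = (∫ ω', (F ω' : ℝ) ∂(law p)) + J₁ p f ω) :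
    variance (fun ω => (F ω : ℝ)) (law p) = ‖f‖ ^ 2 := by
  have hm : Measurable fun ω => (F ω : ℝ) := measurable_from_top.comp hF
  rw [variance_eq_integral hm.aemeasurable, ← norm_J₁ (p := p) f, ← real_inner_self_eq_norm_sq,
    L2.inner_def]
  refine integral_congr_ae ?_
  filter_upwards [hFf] with ω h
  rw [h, Real.inner_apply]
  ring

theorem integral_stein_eq (hF : Measurable F) {lam : ℝ≥0} (hlam : 0 < lam) (A : Set ℕ) :
    ∫ ω, (lam * SteinChen.sol lam A (F ω + 1) - F ω * SteinChen.sol lam A (F ω)) ∂(law p)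
      = ((law p).map F).real A - (poissonMeasure lam).real A := by
  have hA : MeasurableSet (F ⁻¹' A) := hF .of_discrete
  simp only [SteinChen.sol_equation hlam]
  have h : (fun ω => A.indicator (1 : ℕ → ℝ) (F ω)) = (F ⁻¹' A).indicator 1 := rfl
  rw [integral_sub _ (integrable_const _), h, integral_indicator_one hA, integral_const,
    map_measureReal_apply hF .of_discrete]
  · simp
  · rw [h]
    exact (integrable_const 1).indicator hA

/-- The total variation bound on a single set `A`, when the series converges. -/
theorem abs_measureReal_sub_le (hF : Measurable F)
    (hFf : ∀ᵐ ω ∂(law p), (F ω : ℝ) = c + J₁ p f ω) {lam : ℝ≥0} (hlam : 0 < lam)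
    (hsum : Summable fun k =>
      1 / s p k * (|f k ^ 3| + s p k * (p k - q p k) * (f k * |f k|))) (A : Set ℕ) :
    |((law p).map F).real A - (poissonMeasure lam).real A| ≤
      min 1 √(2 / (Real.exp 1 * lam)) * |(lam : ℝ) - c|
        + (1 - Real.exp (-lam)) / lam * |(lam : ℝ) - ‖f‖ ^ 2|
        + (1 - Real.exp (-lam)) / lam *
          ∑' k, 1 / s p k * (|f k ^ 3| + s p k * (p k - q p k) * (f k * |f k|)) := by
  set g := SteinChen.sol lam A with hgdef
  have hC : ∀ k, |g k| ≤ min 1 √(2 / (Real.exp 1 * lam)) := SteinChen.abs_sol_le hlam A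
  have hM : ∀ k, |g (k + 1) - g k| ≤ (1 - Real.exp (-lam)) / lam :=
    SteinChen.abs_sol_succ_sub_le hlam A
  set B := min 1 √(2 / (Real.exp 1 * lam))
  set M := (1 - Real.exp (-lam)) / lam
  have hstein := hasSum_stein hF hFf lam hC
  have h1 : |∫ ω, g (F ω) ∂(law p)| ≤ B :=
    abs_integral_le (ae_of_all _ fun _ => hC _)
  have h2 : |∫ ω, (g (F ω + 1) - g (F ω)) ∂(law p)| ≤ M :=
    abs_integral_le (ae_of_all _ fun _ => hM _)
  have h3 := tsum_of_norm_bounded (hsum.hasSum.mul_left M)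
    fun k => (Real.norm_eq_abs _).trans_le (abs_stein_term_le hF hFf hC hM k)
  rw [hstein.tsum_eq, hgdef, integral_stein_eq hF hlam, ← hgdef, Real.norm_eq_abs] at h3
  set D := ((law p).map F).real A - (poissonMeasure lam).real A
  set a := ∫ ω, g (F ω) ∂(law p)
  set b := ∫ ω, (g (F ω + 1) - g (F ω)) ∂(law p)
  calc |D| = |((lam - c) * a + (lam - ‖f‖ ^ 2) * b)
        + (D - (lam - c) * a - (lam - ‖f‖ ^ 2) * b)| := by ring_nf
    _ ≤ |(lam : ℝ) - c| * |a| + |lam - ‖f‖ ^ 2| * |b|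
        + |D - (lam - c) * a - (lam - ‖f‖ ^ 2) * b| := by
        rw [← abs_mul, ← abs_mul]
        exact (abs_add_le _ _).trans (by gcongr; exact abs_add_le _ _)
    _ ≤ |(lam : ℝ) - c| * B + |lam - ‖f‖ ^ 2| * M + M * _ := by gcongr
    _ = _ := by ring

end Rademacher


theorem theorem3p4 (p : ℕ → Set.Ioo (0 : ℝ) 1) (F : Rademacher.Space → ℕ) (hF : Measurable F)
    (f : lp (fun _ : ℕ => ℝ) 2)
    (hFf : ∀ᵐ ω ∂(Rademacher.law p),
      (F ω : ℝ) = (∫ ω', (F ω' : ℝ) ∂(Rademacher.law p)) + Rademacher.J₁ p f ω)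
    (lam : ℝ≥0) (hlam : 0 < lam) :
    -- both series have nonnegative terms, so that their sums exist in `[0, ∞]`
    (∀ k, 0 ≤ 1 / Rademacher.s p k *
      (|f k ^ 3| + Rademacher.s p k * (p k - Rademacher.q p k) * (f k * |f k|))) ∧
    (∀ k, 0 ≤ 1 / Rademacher.s p k *
      (f k ^ 2 + Rademacher.s p k * (p k - Rademacher.q p k) * f k) * |f k|) ∧
    -- the first bound
    ENNReal.ofReal (Rademacher.dTV ((Rademacher.law p).map F) (poissonMeasure lam)) ≤
      ENNReal.ofReal (min 1 √(2 / (Real.exp 1 * lam)) *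
          |(lam : ℝ) - ∫ ω, (F ω : ℝ) ∂(Rademacher.law p)|)
        + ENNReal.ofReal ((1 - Real.exp (-lam)) / lam * |(lam : ℝ) - ‖f‖ ^ 2|)
        + ENNReal.ofReal ((1 - Real.exp (-lam)) / lam) *
          ∑' k, ENNReal.ofReal (1 / Rademacher.s p k *
            (|f k ^ 3| + Rademacher.s p k * (p k - Rademacher.q p k) * (f k * |f k|))) ∧
    -- the first bound equals the second bound
    ENNReal.ofReal (min 1 √(2 / (Real.exp 1 * lam)) *
          |(lam : ℝ) - ∫ ω, (F ω : ℝ) ∂(Rademacher.law p)|)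
        + ENNReal.ofReal ((1 - Real.exp (-lam)) / lam * |(lam : ℝ) - ‖f‖ ^ 2|)
        + ENNReal.ofReal ((1 - Real.exp (-lam)) / lam) *
          ∑' k, ENNReal.ofReal (1 / Rademacher.s p k *
            (|f k ^ 3| + Rademacher.s p k * (p k - Rademacher.q p k) * (f k * |f k|)))
      = ENNReal.ofReal (min 1 √(2 / (Real.exp 1 * lam)) *
          |(lam : ℝ) - ∫ ω, (F ω : ℝ) ∂(Rademacher.law p)|)
        + ENNReal.ofReal ((1 - Real.exp (-lam)) / lam *
          |(lam : ℝ) - variance (fun ω => (F ω : ℝ)) (Rademacher.law p)|)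
        + ENNReal.ofReal ((1 - Real.exp (-lam)) / lam) *
          ∑' k, ENNReal.ofReal (1 / Rademacher.s p k *
            (f k ^ 2 + Rademacher.s p k * (p k - Rademacher.q p k) * f k) * |f k|) := by
  have hnn := Rademacher.series_term_nonneg hFf
  have hterm := Rademacher.series_term_eq (p := p) (f := f)
  refine ⟨fun k => (hterm k).symm ▸ hnn k, hnn, ?_, ?_⟩
  · have hl : (0 : ℝ) < lam := hlam
    have hM : 0 < (1 - Real.exp (-lam)) / lam :=
      div_pos (sub_pos.2 (by simpa using hl)) hl
    have hpos : ∀ k, 0 ≤ 1 / Rademacher.s p k *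
        (|f k ^ 3| + Rademacher.s p k * (p k - Rademacher.q p k) * (f k * |f k|)) :=
      fun k => (hterm k).symm ▸ hnn k
    by_cases htop : ∑' k, ENNReal.ofReal (1 / Rademacher.s p k *
        (|f k ^ 3| + Rademacher.s p k * (p k - Rademacher.q p k) * (f k * |f k|))) = ∞
    · rw [htop, ENNReal.mul_top (ENNReal.ofReal_pos.2 hM).ne', add_top]
      exact le_top
    · have hsum : Summable fun k => 1 / Rademacher.s p k *
          (|f k ^ 3| + Rademacher.s p k * (p k - Rademacher.q p k) * (f k * |f k|)) := by
        have h := ENNReal.summable_toReal htop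
        simpa only [ENNReal.toReal_ofReal (hpos _)] using h
      rw [← ENNReal.ofReal_tsum_of_nonneg hpos hsum, ← ENNReal.ofReal_mul hM.le,
        ← ENNReal.ofReal_add (by positivity) (by positivity),
        ← ENNReal.ofReal_add (by positivity) (mul_nonneg hM.le (tsum_nonneg hpos))]
      exact ENNReal.ofReal_le_ofReal
        (ciSup_le (Rademacher.abs_measureReal_sub_le hF hFf hlam hsum))
  · rw [Rademacher.variance_eq_norm_sq hF hFf]
    simp only [hterm]
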